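/- Let $I_{n,k}$ be the number of involutions $\pi$ of $\{1,\dots,n\}$ (permutations with $\pi\circ\pi=\mathrm{id}$) that have exactly $k$ descents, i.e. exactly $k$ indices $1\le i\le n-1$ with $\pi(i)>\pi(i+1)$, and let $I_n(t)=\sum_{\pi} t^{\mathrm{d}(\pi)}=\sum_{k=0}^{n-1}I_{n,k}t^k$, where $\pi$ runs over the involutions of $\{1,\dots,n\}$ and $\mathrm{d}(\pi)$ is the number of descents of $\pi$. For $n\ge 1$ and integers $k$ put $$ a_{n,k}= \begin{cases} \displaystyle\sum_{j=0}^{k}(-1)^{k-j}\frac{n-2j-1}{n-k-j-1}\binom{n-k-j-1}{k-j}I_{n,j}, & \text{if } k\ge 0 \text{ and } 2k+1<n,\\[12pt] \displaystyle I_{n,k}+\sum_{j=0}^{k-1}(-1)^{k-j}\frac{n-2j-1}{n-k-j-1}\binom{n-k-j-1}{k-j}I_{n,j}, & \text{if } k\ge 0 \text{ and } 2k+1=n,\\[12pt] 0, & \text{if } k<0 \text{ or } k>(n-1)/2. \end{cases} $$ Then for every $n\ge 1$ $$ I_n(t)=\sum_{k=0}^{\lfloor (n-1)/2\rfloor}a_{n,k}\,t^k(1+t)^{n-2k-1},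 $$ and for all $n\ge 3$ and $k\ge 0$ $$ \begin{aligned} n\,a_{n,k}={}&(k+1)\,a_{n-1,k}+(2n-4k)\,a_{n-1,k-1}+[k(k+2)+n-1]\,a_{n-2,k}\\ &+[(k-1)(4n-8k-14)+2n-8]\,a_{n-2,k-1}+4(n-2k)(n-2k+1)\,a_{n-2,k-2}. \end{aligned} $$ -/

import Mathlib

/-- The number of descents of a permutation of `Fin n`: positions `i` with a successor position
at which the value strictly decreases. -/
def descentNumber {n : ℕ} (π : Equiv.Perm (Fin n)) : ℕ :=
  (Finset.univ.filter fun i : Fin n =>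
    ∃ h : (i : ℕ) + 1 < n, π ⟨(i : ℕ) + 1, h⟩ < π i).card

/-- The involutions of an `n`-element chain, i.e. the permutations `π` with `π (π x) = x` for
all `x` (the identity is one of them). -/
def involutions (n : ℕ) : Finset (Equiv.Perm (Fin n)) :=
  Finset.univ.filter fun π => ∀ x, π (π x) = x

/-- `I_{n,k}`: the number of involutions with exactly `k` descents. -/
def involutionNumber (n k : ℕ) : ℕ :=
  ((involutions n).filter fun π => descentNumber π = k).card

/-- `I_n(t)`: the generating polynomial of the descent number over the involutions. -/
noncomputable def involutionPoly (n : ℕ) : Polynomial ℚ :=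
  ∑ π ∈ involutions n, Polynomial.X ^ descentNumber π

/-- The factor `(-1)^(k-j) (n-2j-1)/(n-k-j-1) * binom(n-k-j-1, k-j)`.
The fraction is computed in `ℚ`. The natural number subtractions in the exponent and in the
binomial coefficient are used only for `j ≤ k` and `2k+1 ≤ n`, where they do not truncate. -/
def gammaWeight (n k j : ℕ) : ℚ :=
  (-1) ^ (k - j) * (((n : ℚ) - 2 * j - 1) / ((n : ℚ) - k - j - 1)) *
    (Nat.choose (n - k - j - 1) (k - j) : ℚ)

/-- `a_{n,k}`, indexed by all integers `k`, with value `0` if `k < 0` or `k > (n-1)/2`. -/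
def gammaCoeff (n : ℕ) (k : ℤ) : ℚ :=
  if k < 0 then 0
  else if 2 * k + 1 < (n : ℤ) then
    ∑ j ∈ Finset.range (k.toNat + 1), gammaWeight n k.toNat j * (involutionNumber n j : ℚ)
  else if 2 * k + 1 = (n : ℤ) then
    (involutionNumber n k.toNat : ℚ) +
      ∑ j ∈ Finset.range k.toNat, gammaWeight n k.toNat j * (involutionNumber n j : ℚ)
  else 0

/-! Let c(m, n) be the number of symmetric m × m matrices over ℕ with entry sum n. Reading a matrix
as a swap-invariant multiset of pairs (f i, f (π i)) matches it with an involution π and a weakly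
increasing f that is strict at the descents of π. Counting such f gives ∑_m c(m, n) X^m = X I_n(X) /
(1 - X)^(n+1) for n ≥ 1 (`symmetricPairsSeries_succ`).

Double counting entries yields (n+2) c(m, n+2) = m c(m, n+1) + (n + m²) c(m, n), in which m acts on
series as θ = X d/dX. The series `gammaSeries n k` correspond to t^k (1+t)^(n-1-2k). Both θ and the
passage from n to n+2 expand these with few terms (`eulerOperator_gammaSeries`, `gammaSeries_eq`),
so expansions for two consecutive n produce the next one, with coefficients given by the stated
recurrence.

An inversion of binomial sums (`gammaCoeff_eq_of_expansion`) shows that the coefficients of any such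
expansion are the a_{n,k}. Induction from n = 1, 2 then gives expansion and recurrence together,
with no separate proof that I_n is palindromic. -/

/-! ### Counting symmetric matrices -/

/-- The multisets of `n` pairs which are invariant under interchanging the components of all
pairs, i.e. the symmetric matrices of natural numbers with entry sum `n`. -/
def symmetricPairs (m n : ℕ) : Finset (Sym (Fin m × Fin m) n) :=
  Finset.univ.filter fun s => s.map Prod.swap = s

theorem mem_symmetricPairs {m n : ℕ} {s : Sym (Fin m × Fin m) n} :
    s ∈ symmetricPairs m n ↔ s.map Prod.swap = s := by
  simp [symmetricPairs]

theorem cons_mem_symmetricPairs {m n : ℕ} (a : Fin m) (s : Sym (Fin m × Fin m) n) :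
    (a, a) ::ₛ s ∈ symmetricPairs m (n + 1) ↔ s ∈ symmetricPairs m n := by
  simp [mem_symmetricPairs, Sym.map_cons]

theorem cons_cons_mem_symmetricPairs {m n : ℕ} (p : Fin m × Fin m)
    (s : Sym (Fin m × Fin m) n) :
    p ::ₛ p.swap ::ₛ s ∈ symmetricPairs m (n + 2) ↔ s ∈ symmetricPairs m n := by
  simp only [mem_symmetricPairs, Sym.map_cons, Prod.swap_swap]
  rw [Sym.cons_swap]
  simp

/-- The total multiplicity of the pair `p` in all symmetric multisets of `n` pairs. -/
def pairOccurrences (m n : ℕ) (p : Fin m × Fin m) : ℕ :=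
  ∑ s ∈ symmetricPairs m n, (s : Multiset (Fin m × Fin m)).count p

/-- Removing one copy of (a, a) preserves symmetry and lowers the multiplicity by one; multisets
without (a, a) contribute nothing. -/
theorem pairOccurrences_diag (m n : ℕ) (a : Fin m) :
    pairOccurrences m (n + 1) (a, a) =
      pairOccurrences m n (a, a) + (symmetricPairs m n).card := by
  have h : ∑ s ∈ symmetricPairs m (n + 1), (s : Multiset (Fin m × Fin m)).count (a, a) =
      ∑ s ∈ (symmetricPairs m n).image (fun s => (a, a) ::ₛ s),
        (s : Multiset (Fin m × Fin m)).count (a, a) := by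
    symm
    apply Finset.sum_subset
    · intro s hs
      obtain ⟨t, ht, rfl⟩ := Finset.mem_image.1 hs
      exact (cons_mem_symmetricPairs a t).2 ht
    · intro s hs hs'
      rw [Multiset.count_eq_zero]
      intro hm
      obtain ⟨t, rfl⟩ := Sym.exists_cons_of_mem (Sym.mem_coe.1 hm)
      exact hs' (Finset.mem_image_of_mem _ ((cons_mem_symmetricPairs a t).1 hs))
  rw [pairOccurrences, h, Finset.sum_image (by intro s _ t _ hst; simpa using hst)]
  have hc : ∀ s : Sym (Fin m × Fin m) n,
      (((a, a) ::ₛ s : Sym _ (n + 1)) : Multiset (Fin m × Fin m)).count (a, a) =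
        (s : Multiset (Fin m × Fin m)).count (a, a) + 1 := fun s => by
    erw [Sym.coe_cons, Multiset.count_cons_self]
  simp [pairOccurrences, Finset.sum_add_distrib, hc]

/-- Symmetry forces `p.swap` to occur along with `p`, so both are removed at once and the size drops
by two. -/
theorem pairOccurrences_of_ne (m n : ℕ) (p : Fin m × Fin m) (hp : p.swap ≠ p) :
    pairOccurrences m (n + 2) p =
      pairOccurrences m n p + (symmetricPairs m n).card := by
  have h : ∑ s ∈ symmetricPairs m (n + 2), (s : Multiset (Fin m × Fin m)).count p =
      ∑ s ∈ (symmetricPairs m n).image (fun s => p ::ₛ p.swap ::ₛ s),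
        (s : Multiset (Fin m × Fin m)).count p := by
    symm
    apply Finset.sum_subset
    · intro s hs
      obtain ⟨t, ht, rfl⟩ := Finset.mem_image.1 hs
      exact (cons_cons_mem_symmetricPairs p t).2 ht
    · intro s hs hs'
      rw [Multiset.count_eq_zero]
      intro hm
      obtain ⟨t, rfl⟩ := Sym.exists_cons_of_mem (Sym.mem_coe.1 hm)
      have h1 : p.swap ∈ p ::ₛ t := by
        rw [← mem_symmetricPairs.1 hs, Sym.mem_map]
        exact ⟨p, Sym.mem_cons_self _ _, rfl⟩
      obtain ⟨t, rfl⟩ := Sym.exists_cons_of_mem ((Sym.mem_cons.1 h1).resolve_left hp)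
      exact hs' (Finset.mem_image_of_mem _ ((cons_cons_mem_symmetricPairs p t).1 hs))
  rw [pairOccurrences, h, Finset.sum_image (by intro s _ t _ hst; simpa using hst)]
  have hc : ∀ s : Sym (Fin m × Fin m) n,
      ((p ::ₛ p.swap ::ₛ s : Sym _ (n + 2)) : Multiset (Fin m × Fin m)).count p =
        (s : Multiset (Fin m × Fin m)).count p + 1 := fun s => by
    erw [Sym.coe_cons, Multiset.count_cons_self, Sym.coe_cons,
      Multiset.count_cons_of_ne hp.symm]
  simp [pairOccurrences, Finset.sum_add_distrib, hc]

theorem sum_pairOccurrences (m n : ℕ) :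
    ∑ p, pairOccurrences m n p = n * (symmetricPairs m n).card := by
  simp only [pairOccurrences]
  rw [Finset.sum_comm, Finset.sum_congr rfl (g := fun _ => n), Finset.sum_const, smul_eq_mul,
    mul_comm]
  intro s _
  rw [Multiset.sum_count_eq_card (by simp), Sym.card_coe]

theorem card_symmetricPairs_recurrence (m n : ℕ) :
    (n + 2) * (symmetricPairs m (n + 2)).card =
      m * (symmetricPairs m (n + 1)).card + (n + m ^ 2) * (symmetricPairs m n).card := by
  have key : ∀ p : Fin m × Fin m, pairOccurrences m (n + 2) p = pairOccurrences m n p +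
      ((symmetricPairs m n).card +
        if p.1 = p.2 then (symmetricPairs m (n + 1)).card else 0) := by
    rintro ⟨a, b⟩
    by_cases hab : a = b
    · subst hab
      rw [pairOccurrences_diag, pairOccurrences_diag]
      simp [add_assoc]
    · rw [pairOccurrences_of_ne _ _ _ (fun h => hab (Prod.mk.inj h).2)]
      simp [hab]
  rw [← sum_pairOccurrences, Finset.sum_congr rfl fun p _ => key p, Finset.sum_add_distrib,
    sum_pairOccurrences, Finset.sum_add_distrib,
    Fintype.sum_prod_type (f := fun p : Fin m × Fin m =>
      if p.1 = p.2 then (symmetricPairs m (n + 1)).card else 0)]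
  simp
  ring

/-! ### Maps compatible with the descents of a permutation -/

theorem card_filter_strictMono (n N : ℕ) :
    (Finset.univ.filter fun g : Fin n → Fin N => StrictMono g).card = N.choose n := by
  classical
  rw [← Finset.card_fin N, ← Finset.card_powersetCard, Finset.card_fin]
  refine Finset.card_bij (fun g _ => Finset.univ.image g) ?_ ?_ ?_
  · intro g hg
    simp only [Finset.mem_filter, Finset.mem_univ, true_and] at hg
    simp [Finset.mem_powersetCard, Finset.card_image_of_injective _ hg.injective]
  · intro g hg g' hg' h
    simp only [Finset.mem_filter, Finset.mem_univ, true_and] at hg hg'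
    refine (hg.range_inj hg').1 ?_
    simpa [Set.ext_iff, Finset.ext_iff] using h
  · intro s hs
    rw [Finset.mem_powersetCard] at hs
    refine ⟨s.orderEmbOfFin hs.2, by simpa using (s.orderEmbOfFin hs.2).strictMono, ?_⟩
    apply Finset.coe_injective
    simp

/-- A map `f` is compatible with `π` if it is weakly increasing, and strictly increasing at the
descents of `π`. -/
def DescentCompatible {n m : ℕ} (π : Equiv.Perm (Fin n)) (f : Fin n → Fin m) : Prop :=
  Monotone f ∧ ∀ (i : Fin n) (h : (i : ℕ) + 1 < n), π ⟨(i : ℕ) + 1, h⟩ < π i →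
    f i < f ⟨(i : ℕ) + 1, h⟩

/-- The number of ascents of `π` strictly before position `i`. -/
def ascentsBefore {n : ℕ} (π : Equiv.Perm (Fin n)) (i : ℕ) : ℕ :=
  ((Finset.range i).filter fun j => ∃ h : j + 1 < n,
    π ⟨j, (Nat.lt_succ_self j).trans h⟩ < π ⟨j + 1, h⟩).card

theorem ascentsBefore_succ {n : ℕ} (π : Equiv.Perm (Fin n)) (i : ℕ) (h : i + 1 < n) :
    ascentsBefore π (i + 1) = ascentsBefore π i +
      if π ⟨i + 1, h⟩ < π ⟨i, (Nat.lt_succ_self i).trans h⟩ then 0 else 1 := by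
  have hne : π ⟨i, (Nat.lt_succ_self i).trans h⟩ ≠ π ⟨i + 1, h⟩ := fun he => by
    simpa using congrArg Fin.val (π.injective he)
  unfold ascentsBefore
  rw [Finset.range_add_one, Finset.filter_insert]
  by_cases hd : π ⟨i + 1, h⟩ < π ⟨i, (Nat.lt_succ_self i).trans h⟩
  · simp [h, hd, hd.not_gt]
  · simp [h, hd, lt_of_le_of_ne (not_lt.1 hd) hne]

theorem descentNumber_add_ascentsBefore {n : ℕ} (π : Equiv.Perm (Fin (n + 1))) :
    descentNumber π + ascentsBefore π n = n := by
  have hd : descentNumber π = ((Finset.range n).filter fun j => ¬ ∃ h : j + 1 < n + 1,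
      π ⟨j, (Nat.lt_succ_self j).trans h⟩ < π ⟨j + 1, h⟩).card := by
    unfold descentNumber
    refine Finset.card_bij (fun i _ => (i : ℕ)) ?_ ?_ ?_
    · intro i hi
      simp only [Finset.mem_filter, Finset.mem_univ, true_and] at hi
      obtain ⟨h, hi⟩ := hi
      simp only [Finset.mem_filter, Finset.mem_range, not_exists, not_lt]
      exact ⟨by omega, fun _ => hi.le⟩
    · intro i _ j _ h
      exact Fin.ext h
    · intro j hj
      simp only [Finset.mem_filter, Finset.mem_range, not_exists, not_lt] at hj
      refine ⟨⟨j, by omega⟩, ?_, rfl⟩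
      simp only [Finset.mem_filter, Finset.mem_univ, true_and]
      refine ⟨by omega, lt_of_le_of_ne (hj.2 (by omega)) fun he => ?_⟩
      simpa using congrArg Fin.val (π.injective he)
  rw [hd, ascentsBefore, add_comm, Finset.card_filter_add_card_filter_not, Finset.card_range]

theorem monotone_fin_of_succ {n : ℕ} {α : Type*} [Preorder α] {f : Fin n → α}
    (hf : ∀ (i : ℕ) (h : i + 1 < n), f ⟨i, (Nat.lt_succ_self i).trans h⟩ ≤ f ⟨i + 1, h⟩) :
    Monotone f := by
  rcases n with _ | n
  · exact fun i => i.elim0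
  · exact Fin.monotone_iff_le_succ.2 fun i => hf i (by omega)

theorem strictMono_fin_of_succ {n : ℕ} {α : Type*} [Preorder α] {f : Fin n → α}
    (hf : ∀ (i : ℕ) (h : i + 1 < n), f ⟨i, (Nat.lt_succ_self i).trans h⟩ < f ⟨i + 1, h⟩) :
    StrictMono f := by
  rcases n with _ | n
  · exact fun i => i.elim0
  · exact Fin.strictMono_iff_lt_succ.2 fun i => hf i (by omega)

open Classical in
-- Adding to f i the number of ascents before i makes f strictly increasing: f itself rises at
-- descents, the shift at ascents. The target grows from m to m plus the number of ascents, n -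
-- d(π).
theorem card_filter_descentCompatible {n : ℕ} (m : ℕ) (π : Equiv.Perm (Fin (n + 1))) :
    (Finset.univ.filter fun f : Fin (n + 1) → Fin m => DescentCompatible π f).card =
      (m + n - descentNumber π).choose (n + 1) := by
  have htot := descentNumber_add_ascentsBefore π
  rw [← card_filter_strictMono]
  have hmono : Monotone fun i : Fin (n + 1) => ascentsBefore π i :=
    monotone_fin_of_succ fun i h => by
      simp only [ascentsBefore_succ π i h]
      omega
  have hle : ∀ i : Fin (n + 1), ascentsBefore π i ≤ ascentsBefore π n := fun i =>
    hmono (Fin.le_last i)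
  refine Finset.card_bij (fun f _ i => ⟨(f i : ℕ) + ascentsBefore π i, by
    have := (f i).2
    have := hle i
    omega⟩) ?_ ?_ ?_
  · intro f hf
    simp only [Finset.mem_filter, Finset.mem_univ, true_and] at hf ⊢
    refine strictMono_fin_of_succ fun i h => ?_
    rw [Fin.lt_def]
    simp only [ascentsBefore_succ π i h]
    split_ifs with hd
    · have := Fin.lt_def.1 (hf.2 ⟨i, by omega⟩ h hd)
      simp only at this
      omega
    · have h1 : f ⟨i, by omega⟩ ≤ f ⟨i + 1, h⟩ := hf.1 (Fin.mk_le_mk.2 (by omega))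
      have := Fin.le_def.1 h1
      omega
  · intro f _ f' _ h
    ext i
    have := congrArg Fin.val (congrFun h i)
    simpa using this
  · intro g hg
    simp only [Finset.mem_filter, Finset.mem_univ, true_and] at hg
    have hstep : ∀ (i : ℕ) (h : i + 1 < n + 1),
        (g ⟨i, by omega⟩ : ℕ) + 1 ≤ g ⟨i + 1, h⟩ := fun i h =>
      Fin.lt_def.1 (hg (Fin.mk_lt_mk.2 (Nat.lt_succ_self i)))
    -- Ensures that the subtraction inverting the shift does not truncate.
    have hge : ∀ (i : ℕ) (h : i < n + 1), ascentsBefore π i ≤ g ⟨i, h⟩ := by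
      intro i
      induction i with
      | zero => simp [ascentsBefore]
      | succ i ih =>
        intro h
        have h1 := ih (by omega)
        have h2 := hstep i h
        rw [ascentsBefore_succ π i h]
        split_ifs <;> omega
    have hmono' : Monotone fun i : Fin (n + 1) => (g i : ℕ) - ascentsBefore π i :=
      monotone_fin_of_succ fun i h => by
        have h1 := hge i (by omega)
        have h2 := hstep i h
        simp only [ascentsBefore_succ π i h]
        split_ifs <;> omega
    have hlt : ∀ i : Fin (n + 1), (g i : ℕ) - ascentsBefore π i < m := fun i => by
      have h1 : (g i : ℕ) - ascentsBefore π i ≤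
          (g (Fin.last n) : ℕ) - ascentsBefore π n := hmono' (Fin.le_last i)
      have h2 := (g (Fin.last n)).2
      have h3 := hge n (by omega)
      change ascentsBefore π n ≤ g (Fin.last n) at h3
      omega
    refine ⟨fun i => ⟨(g i : ℕ) - ascentsBefore π i, hlt i⟩, ?_, ?_⟩
    · simp only [Finset.mem_filter, Finset.mem_univ, true_and]
      refine ⟨fun i j h => Fin.mk_le_mk.2 (hmono' h), fun i h hd => Fin.mk_lt_mk.2 ?_⟩
      have h1 := hge i i.2
      have h2 := hstep i h
      simp only [ascentsBefore_succ π i h, hd, if_true]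
      simp only [Fin.eta] at *
      omega
    · ext i
      have := hge i i.2
      simp only [Fin.eta] at *
      omega

/-! ### Involutions with compatible maps versus symmetric matrices -/

theorem Tuple.eq_of_monotone_of_map_univ_eq {n : ℕ} {α : Type*} [LinearOrder α]
    {f g : Fin n → α} (hf : Monotone f) (hg : Monotone g)
    (h : Finset.univ.val.map f = Finset.univ.val.map g) : f = g := by
  have hp : (List.ofFn f).Perm (List.ofFn g) := by
    rw [← Multiset.coe_eq_coe]
    simpa [List.ofFn_eq_map, Fin.univ_val_map] using h
  exact List.ofFn_injective (hp.eq_of_pairwise' hf.sortedLE_ofFn.pairwise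
    hg.sortedLE_ofFn.pairwise)

theorem Tuple.map_univ_comp_perm {n : ℕ} {α : Type*} (f : Fin n → α)
    (σ : Equiv.Perm (Fin n)) :
    (Finset.univ.val.map (f ∘ σ)) = Finset.univ.val.map f := by
  rw [← Multiset.map_map, Multiset.map_univ_val_equiv]

/-- Interchange of the components of a lexicographically ordered pair. -/
def lexSwap {m : ℕ} (p : Fin m ×ₗ Fin m) : Fin m ×ₗ Fin m :=
  toLex (ofLex p).swap

@[simp]
theorem lexSwap_lexSwap {m : ℕ} (p : Fin m ×ₗ Fin m) : lexSwap (lexSwap p) = p := rfl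

/-- The word of pairs `(f i, f (π i))`. -/
def pairWord {n m : ℕ} (π : Equiv.Perm (Fin n)) (f : Fin n → Fin m) (i : Fin n) :
    Fin m ×ₗ Fin m :=
  toLex (f i, f (π i))

/-- f is constant between i and j, so π has no descent there. -/
theorem DescentCompatible.lt_of_eq {n m : ℕ} {π : Equiv.Perm (Fin n)} {f : Fin n → Fin m}
    (h : DescentCompatible π f) {i j : Fin n} (hij : i < j) (hf : f i = f j) : π i < π j := by
  obtain ⟨i, hi⟩ := i
  obtain ⟨j, hj⟩ := j
  rw [Fin.mk_lt_mk] at hij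
  induction j, hij using Nat.le_induction with
  | base =>
    by_contra hlt
    have hne : π ⟨i, hi⟩ ≠ π ⟨i + 1, hj⟩ := fun he => by
      simpa using congrArg Fin.val (π.injective he)
    exact (h.2 ⟨i, hi⟩ hj (lt_of_le_of_ne (not_lt.1 hlt) hne.symm)).ne hf
  | succ j hij ih =>
    have h1 : f ⟨i, hi⟩ ≤ f ⟨j, by omega⟩ := h.1 (Fin.mk_le_mk.2 (by omega))
    have h2 : f ⟨j, by omega⟩ ≤ f ⟨j + 1, hj⟩ := h.1 (Fin.mk_le_mk.2 (by omega))
    have h3 : f ⟨j, by omega⟩ = f ⟨j + 1, hj⟩ := le_antisymm h2 (hf ▸ h1)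
    refine (ih (by omega) (hf.trans h3.symm)).trans ?_
    by_contra hlt
    have hne : π ⟨j, by omega⟩ ≠ π ⟨j + 1, hj⟩ := fun he => by
      simpa using congrArg Fin.val (π.injective he)
    exact (h.2 ⟨j, by omega⟩ hj (lt_of_le_of_ne (not_lt.1 hlt) hne.symm)).ne h3

theorem DescentCompatible.monotone_pairWord {n m : ℕ} {π : Equiv.Perm (Fin n)}
    {f : Fin n → Fin m} (h : DescentCompatible π f) : Monotone (pairWord π f) := by
  refine monotone_iff_forall_lt.2 fun i j hij => ?_
  rw [pairWord, pairWord, Prod.Lex.toLex_le_toLex]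
  rcases (h.1 hij.le).lt_or_eq with hlt | heq
  · exact Or.inl hlt
  · exact Or.inr ⟨heq, h.1 (h.lt_of_eq hij heq).le⟩

theorem lexSwap_comp_pairWord {n m : ℕ} {π : Equiv.Perm (Fin n)} (hπ : ∀ x, π (π x) = x)
    (f : Fin n → Fin m) : lexSwap ∘ pairWord π f = pairWord π f ∘ π := by
  funext i
  simp [lexSwap, pairWord, hπ]

/-- Makes π recoverable from the word: π rearranges the swapped word into the monotone one and keeps
ties in order, which characterizes the stable sort. -/
theorem DescentCompatible.eq_sort {n m : ℕ} {π : Equiv.Perm (Fin n)} (hπ : ∀ x, π (π x) = x)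
    {f : Fin n → Fin m} (h : DescentCompatible π f) :
    π = Tuple.sort (lexSwap ∘ pairWord π f) := by
  have hc : (lexSwap ∘ pairWord π f) ∘ π = pairWord π f := by
    funext i
    simp [lexSwap, pairWord, hπ]
  rw [Tuple.eq_sort_iff]
  refine ⟨hc.symm ▸ h.monotone_pairWord, fun i j hij he => h.lt_of_eq hij ?_⟩
  have he' := (congrFun hc i).symm.trans (he.trans (congrFun hc j))
  exact congrArg (fun p => (ofLex p).1) he'

/-- Surjectivity: π is taken to be the stable sort of the swapped word. Its square fixes w and
preserves the order of ties, hence is the sort of the already monotone w, the identity. -/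
theorem exists_pairWord_eq {n m : ℕ} {w : Fin n → Fin m ×ₗ Fin m} (hw : Monotone w)
    (hs : Finset.univ.val.map (lexSwap ∘ w) = Finset.univ.val.map w) :
    ∃ (π : Equiv.Perm (Fin n)) (f : Fin n → Fin m),
      (∀ x, π (π x) = x) ∧ DescentCompatible π f ∧ pairWord π f = w := by
  obtain ⟨π, hπ⟩ : ∃ π, π = Tuple.sort (lexSwap ∘ w) := ⟨_, rfl⟩
  have hsort := Tuple.eq_sort_iff.1 hπ
  have hc : (lexSwap ∘ w) ∘ π = w := Tuple.eq_of_monotone_of_map_univ_eq hsort.1 hw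
    ((Tuple.map_univ_comp_perm _ _).trans hs)
  have hc' : ∀ i, w (π i) = lexSwap (w i) := fun i => by
    rw [← congrFun hc i]
    simp
  have hlt : ∀ i j, i < j → w i = w j → π i < π j := fun i j hij he =>
    hsort.2 i j hij (by simp [hc', he])
  have hinv : π * π = 1 := by
    have h1 : π * π = Tuple.sort w := by
      rw [Tuple.eq_sort_iff]
      have hww : w ∘ (π * π : Equiv.Perm (Fin n)) = w := by
        funext i
        simp [hc']
      refine ⟨hww.symm ▸ hw, fun i j hij he => ?_⟩
      have he' : w i = w j := by
        rw [← congrFun hww i, ← congrFun hww j]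
        exact he
      exact hlt _ _ (hlt _ _ hij he') (by rw [hc', hc', he'])
    rw [h1]
    exact Tuple.sort_eq_refl_iff_monotone.2 hw
  have hf : Monotone fun i => (ofLex (w i)).1 := fun i j hij => by
    rcases Prod.Lex.le_iff.1 (hw hij) with h | h
    · exact h.le
    · exact h.1.le
  have hsnd : ∀ i, (ofLex (w (π i))).1 = (ofLex (w i)).2 := fun i => by rw [hc']; rfl
  refine ⟨π, fun i => (ofLex (w i)).1, fun x => by simpa using DFunLike.congr_fun hinv x,
    ⟨hf, fun i h hd => ?_⟩, ?_⟩
  · have hij : i < ⟨(i : ℕ) + 1, h⟩ := Fin.lt_def.2 (Nat.lt_succ_self _)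
    -- With equal first components, a strict rise of the second contradicts monotonicity of f at the
    -- descent, and equal pairs force π to ascend.
    rcases Prod.Lex.le_iff.1 (hw hij.le) with h1 | ⟨h1, h2⟩
    · exact h1
    · exfalso
      rcases h2.lt_or_eq with h2 | h2
      · rw [← hsnd, ← hsnd] at h2
        exact (hf hd.le).not_gt h2
      · exact (hlt _ _ hij (ofLex.injective (Prod.ext h1 h2))).not_gt hd
  · funext i
    simp only [pairWord, hsnd]
    rfl

/-- The pairs of an involution and a map to `Fin m` compatible with its descents. -/
noncomputable def compatiblePairs (n m : ℕ) :
    Finset (Σ _ : Equiv.Perm (Fin n), Fin n → Fin m) :=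
  open Classical in
  (involutions n).sigma fun π => Finset.univ.filter fun f => DescentCompatible π f

theorem card_compatiblePairs_eq_sum (n m : ℕ) :
    (compatiblePairs (n + 1) m).card =
      ∑ π ∈ involutions (n + 1), (m + n - descentNumber π).choose (n + 1) := by
  classical
  rw [compatiblePairs, Finset.card_sigma]
  refine Finset.sum_congr rfl fun π _ => ?_
  rw [← card_filter_descentCompatible]

theorem mem_compatiblePairs {n m : ℕ} {q : Σ _ : Equiv.Perm (Fin n), Fin n → Fin m} :
    q ∈ compatiblePairs n m ↔ (∀ x, q.1 (q.1 x) = x) ∧ DescentCompatible q.1 q.2 := by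
  classical
  simp [compatiblePairs, involutions]

theorem map_ofLex_lexSwap {n m : ℕ} (w : Fin n → Fin m ×ₗ Fin m) :
    Finset.univ.val.map (fun i => ofLex ((lexSwap ∘ w) i)) =
      (Finset.univ.val.map fun i => ofLex (w i)).map Prod.swap := by
  rw [Multiset.map_map]
  rfl

theorem map_univ_eq_of_map_ofLex_eq {n m : ℕ} {w w' : Fin n → Fin m ×ₗ Fin m}
    (h : (Finset.univ.val.map fun i => ofLex (w i)) = Finset.univ.val.map fun i => ofLex (w' i)) :
    Finset.univ.val.map w = Finset.univ.val.map w' := by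
  apply Multiset.map_injective (ofLex (α := Fin m × Fin m)).injective
  rw [Multiset.map_map, Multiset.map_map]
  exact h

theorem card_compatiblePairs (n m : ℕ) :
    (compatiblePairs n m).card = (symmetricPairs m n).card := by
  refine Finset.card_bij (fun q _ => Sym.mk
    (Finset.univ.val.map fun i => ofLex (pairWord q.1 q.2 i)) (by simp)) ?_ ?_ ?_
  · rintro ⟨π, f⟩ hq
    have hq := mem_compatiblePairs.1 hq
    rw [mem_symmetricPairs]
    apply Sym.ext
    rw [Sym.coe_map, Sym.coe_mk, ← map_ofLex_lexSwap, lexSwap_comp_pairWord hq.1]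
    exact Tuple.map_univ_comp_perm (fun i => ofLex (pairWord π f i)) π
  · rintro ⟨π, f⟩ hq ⟨π', f'⟩ hq' h
    have hq : (∀ x, π (π x) = x) ∧ DescentCompatible π f := mem_compatiblePairs.1 hq
    have hq' : (∀ x, π' (π' x) = x) ∧ DescentCompatible π' f' :=
      mem_compatiblePairs.1 hq'
    have h1 : (Finset.univ.val.map fun i => ofLex (pairWord π f i)) =
      Finset.univ.val.map fun i => ofLex (pairWord π' f' i) := congrArg Sym.toMultiset h
    have h2 : pairWord π f = pairWord π' f' :=
      Tuple.eq_of_monotone_of_map_univ_eq hq.2.monotone_pairWord hq'.2.monotone_pairWord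
        (map_univ_eq_of_map_ofLex_eq h1)
    have h3 : π = π' := by
      rw [hq.2.eq_sort hq.1, hq'.2.eq_sort hq'.1]
      exact congrArg (fun w => Tuple.sort (lexSwap ∘ w)) h2
    have h4 : f = f' := funext fun i => congrArg (fun p => (ofLex p).1) (congrFun h2 i)
    rw [h3, h4]
  · intro s hs
    rw [mem_symmetricPairs] at hs
    obtain ⟨w, hw, hws⟩ : ∃ w : Fin n → Fin m ×ₗ Fin m, Monotone w ∧
        (Finset.univ.val.map fun i => ofLex (w i)) = s := by
      obtain ⟨l, hl⟩ := Quot.exists_rep (s : Multiset (Fin m × Fin m))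
      have hn : l.length = n := by
        have := congrArg Multiset.card hl
        simpa using this
      subst hn
      let g : Fin l.length → Fin m ×ₗ Fin m := fun i => toLex (l.get i)
      refine ⟨g ∘ Tuple.sort g, Tuple.monotone_sort g, ?_⟩
      rw [← hl]
      refine (Tuple.map_univ_comp_perm (fun i => l.get i) (Tuple.sort g)).trans ?_
      rw [Fin.univ_val_map, List.ofFn_get]
      rfl
    have hsym : Finset.univ.val.map (lexSwap ∘ w) = Finset.univ.val.map w := by
      have h1 := map_ofLex_lexSwap w
      rw [hws, ← Sym.coe_map, hs, ← hws] at h1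
      exact map_univ_eq_of_map_ofLex_eq h1
    obtain ⟨π, f, h1, h2, h3⟩ := exists_pairWord_eq hw hsym
    refine ⟨⟨π, f⟩, mem_compatiblePairs.2 ⟨h1, h2⟩, ?_⟩
    apply Sym.ext
    rw [Sym.coe_mk, ← hws, h3]

/-! ### Generating functions and the action of X d/dX -/

open PowerSeries in
/-- The geometric series `1 / (1 - X)`. -/
noncomputable def geomSeries : ℚ⟦X⟧ := PowerSeries.mk 1

open PowerSeries in
theorem geomSeries_mul_one_sub : geomSeries * (1 - X : ℚ⟦X⟧) = 1 :=
  PowerSeries.mk_one_mul_one_sub_eq_one ℚ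

open PowerSeries in
theorem derivative_geomSeries : d⁄dX ℚ geomSeries = geomSeries ^ 2 := by
  have h := congrArg (d⁄dX ℚ) geomSeries_mul_one_sub
  rw [Derivation.leibniz, map_sub, PowerSeries.derivative_X, Derivation.map_one_eq_zero] at h
  simp only [smul_eq_mul] at h
  linear_combination geomSeries * h - d⁄dX ℚ geomSeries * geomSeries_mul_one_sub

open PowerSeries in
/-- The operator `X * d/dX` on power series. -/
noncomputable def eulerOperator : ℚ⟦X⟧ →ₗ[ℚ] ℚ⟦X⟧ :=
  LinearMap.mulLeft ℚ (X : ℚ⟦X⟧) ∘ₗ (d⁄dX ℚ : Derivation ℚ ℚ⟦X⟧ ℚ⟦X⟧).toLinearMap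

open PowerSeries in
theorem eulerOperator_apply (f : ℚ⟦X⟧) : eulerOperator f = X * d⁄dX ℚ f := rfl

open PowerSeries in
theorem coeff_eulerOperator (f : ℚ⟦X⟧) (m : ℕ) :
    coeff m (eulerOperator f) = m * coeff m f := by
  rw [eulerOperator_apply]
  rcases m with _ | m
  · simp
  · rw [coeff_succ_X_mul, coeff_derivative]
    push_cast
    ring

open PowerSeries in
/-- The series `X ^ (k + 1) * (1 + X) ^ (n - 1 - 2k) / (1 - X) ^ (n + 1)`. -/
noncomputable def gammaSeries (n k : ℕ) : ℚ⟦X⟧ :=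
  X ^ (k + 1) * (1 + X) ^ (n - 1 - 2 * k) * geomSeries ^ (n + 1)

open PowerSeries in
-- With M = n - 1 - 2k, the logarithmic derivative (k+1) + MX/(1+X) + (n+1)X/(1-X) has numerator
-- (k+1)(1+X)² + 2MX over 1 - X².
theorem eulerOperator_gammaSeries {n k : ℕ} (h : 2 * k + 1 ≤ n) :
    eulerOperator (gammaSeries n k) = ((k : ℚ) + 1) • gammaSeries (n + 1) k +
      (2 * ((n : ℚ) - 1 - 2 * k)) • gammaSeries (n + 1) (k + 1) := by
  obtain ⟨M, rfl⟩ := Nat.exists_eq_add_of_le h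
  have e1 : 2 * k + 1 + M - 1 - 2 * k = M := by omega
  have e2 : 2 * k + 1 + M + 1 - 1 - 2 * k = M + 1 := by omega
  -- This exponent truncates at M = 0, where the coefficient 2M vanishes.
  have e3 : 2 * k + 1 + M + 1 - 1 - 2 * (k + 1) = M - 1 := by omega
  have e4 : 2 * ((((2 * k + 1 + M : ℕ) : ℚ)) - 1 - 2 * k) = 2 * M := by push_cast; ring
  simp only [gammaSeries, e1, e2, e3, e4, eulerOperator_apply]
  simp only [Derivation.leibniz, Derivation.leibniz_pow, map_add, Derivation.map_one_eq_zero,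
    PowerSeries.derivative_X, derivative_geomSeries, smul_eq_mul, nsmul_eq_mul,
    PowerSeries.smul_eq_C_mul, map_add, map_mul, map_natCast, map_one, map_ofNat]
  have hu := geomSeries_mul_one_sub
  simp only [Nat.add_sub_cancel]
  rcases M with _ | M
  · push_cast
    linear_combination -(((k : ℚ⟦X⟧) + 1) * X ^ (k + 1) * geomSeries ^ (2 * k + 2)) * hu
  · simp only [Nat.add_sub_cancel]
    push_cast
    linear_combination -((((k : ℚ⟦X⟧) + 1) * X ^ (k + 1) * (1 + X) ^ (M + 1) +
      ((M : ℚ⟦X⟧) + 1) * X ^ (k + 2) * (1 + X) ^ M) * geomSeries ^ (2 * k + M + 3)) * hu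

open PowerSeries in
-- This is (1-X)² = (1+X)² - 4X.
theorem gammaSeries_eq {n k : ℕ} (h : 2 * k + 1 ≤ n) :
    gammaSeries n k = gammaSeries (n + 2) k - (4 : ℚ) • gammaSeries (n + 2) (k + 1) := by
  obtain ⟨M, rfl⟩ := Nat.exists_eq_add_of_le h
  have e1 : 2 * k + 1 + M - 1 - 2 * k = M := by omega
  have e2 : 2 * k + 1 + M + 2 - 1 - 2 * k = M + 2 := by omega
  have e3 : 2 * k + 1 + M + 2 - 1 - 2 * (k + 1) = M := by omega
  simp only [gammaSeries, e1, e2, e3, PowerSeries.smul_eq_C_mul, map_ofNat]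
  have hu : geomSeries ^ 2 * (1 - X : ℚ⟦X⟧) ^ 2 = 1 := by
    rw [← mul_pow, geomSeries_mul_one_sub, one_pow]
  linear_combination -(X ^ (k + 1) * (1 + X) ^ M * geomSeries ^ (2 * k + 1 + M + 1)) * hu

open PowerSeries in
/-- The generating function of the number of symmetric matrices with entry sum `n`. -/
noncomputable def symmetricPairsSeries (n : ℕ) : ℚ⟦X⟧ :=
  PowerSeries.mk fun m => ((symmetricPairs m n).card : ℚ)

open PowerSeries in
theorem symmetricPairsSeries_recurrence (n : ℕ) :
    ((n : ℚ) + 2) • symmetricPairsSeries (n + 2) =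
      eulerOperator (symmetricPairsSeries (n + 1)) + (n : ℚ) • symmetricPairsSeries n +
        eulerOperator (eulerOperator (symmetricPairsSeries n)) := by
  ext m
  have h := congrArg (Nat.cast (R := ℚ)) (card_symmetricPairs_recurrence m n)
  push_cast at h
  simp only [map_add, map_smul, coeff_eulerOperator, symmetricPairsSeries, coeff_mk, smul_eq_mul]
  linear_combination h

open PowerSeries in
theorem symmetricPairsSeries_succ (n : ℕ) :
    symmetricPairsSeries (n + 1) =
      X * (involutionPoly (n + 1) : ℚ⟦X⟧) * geomSeries ^ (n + 2) := by
  ext m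
  have h1 : (involutionPoly (n + 1) : ℚ⟦X⟧) =
      ∑ π ∈ involutions (n + 1), X ^ descentNumber π := by
    rw [involutionPoly, ← Polynomial.coeToPowerSeries.ringHom_apply, map_sum]
    simp
  rw [h1, Finset.mul_sum, Finset.sum_mul, map_sum, symmetricPairsSeries, coeff_mk,
    ← card_compatiblePairs, card_compatiblePairs_eq_sum, Nat.cast_sum]
  refine Finset.sum_congr rfl fun π _ => ?_
  rw [← pow_succ', geomSeries, mk_one_pow_eq_mk_choose_add, coeff_X_pow_mul']
  split_ifs with h
  · rw [coeff_mk]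
    congr 2
    omega
  · rw [Nat.choose_eq_zero_of_lt (by omega), Nat.cast_zero]

/-! ### Inverting the expansion -/

/-- Vandermonde for (1+x)^N (1+x)^(-(M+1)). -/
theorem sum_choose_mul_neg_one_pow_choose (M N k : ℕ) (h : M + 1 ≤ N) :
    ∑ x ∈ Finset.range (k + 1),
      (-1 : ℚ) ^ (k - x) * ((M + (k - x)).choose (k - x) : ℚ) * (N.choose x : ℚ) =
      ((N - (M + 1)).choose k : ℚ) := by
  have hneg : ∀ a : ℕ, Ring.choose (-((M + 1 : ℕ) : ℤ)) a = (-1) ^ a * ((M + a).choose a : ℤ) := by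
    intro a
    have e : ((M + 1 : ℕ) : ℤ) + a - 1 = ((M + a : ℕ) : ℤ) := by push_cast; ring
    rw [Ring.choose_neg, e, Ring.choose_natCast, Int.negOnePow_def, Units.smul_def]
    simp
  have key := Ring.add_choose_eq (R := ℤ) (r := (N : ℤ)) (s := -((M + 1 : ℕ) : ℤ)) k
    (Commute.all _ _)
  rw [← sub_eq_add_neg, ← Nat.cast_sub h, Ring.choose_natCast,
    Finset.Nat.sum_antidiagonal_eq_sum_range_succ
      (fun i j => Ring.choose (N : ℤ) i * Ring.choose (-((M + 1 : ℕ) : ℤ)) j)] at key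
  have key' := congrArg (Int.cast (R := ℚ)) key
  simp only [hneg, Ring.choose_natCast] at key'
  push_cast at key'
  rw [key']
  exact Finset.sum_congr rfl fun x _ => by ring

/-- The coefficients `(-1)^a * (binom (M + a) a + binom (M + a - 1) (a - 1))` inverting the
expansion of a palindromic polynomial in the basis `X ^ k * (1 + X) ^ (N - 2k)`. -/
def inversionWeight (M : ℕ) : ℕ → ℚ
  | 0 => 1
  | a + 1 => (-1) ^ (a + 1) * (((M + (a + 1)).choose (a + 1) : ℚ) + ((M + a).choose a : ℚ))

/-- The weights have generating function (1-x)(1+x)^(-(M+1)), so for k > 0 the sum is the x^k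
coefficient of (1-x)(1+x)^(2k-1), zero by symmetry of binomials. -/
theorem sum_inversionWeight_mul_choose (M k : ℕ) :
    ∑ x ∈ Finset.range (k + 1), inversionWeight M (k - x) * ((M + 2 * k).choose x : ℚ) =
      if k = 0 then 1 else 0 := by
  rcases k with _ | k
  · simp [inversionWeight]
  have h1 := sum_choose_mul_neg_one_pow_choose M (M + 2 * (k + 1)) (k + 1) (by omega)
  have h2 := sum_choose_mul_neg_one_pow_choose M (M + 2 * (k + 1)) k (by omega)
  have e : M + 2 * (k + 1) - (M + 1) = 2 * k + 1 := by omega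
  rw [e, Finset.sum_range_succ] at h1
  rw [e] at h2
  rw [Finset.sum_range_succ, if_neg (Nat.succ_ne_zero k)]
  have h3 : ∑ x ∈ Finset.range (k + 1),
      inversionWeight M (k + 1 - x) * ((M + 2 * (k + 1)).choose x : ℚ) =
      ∑ x ∈ Finset.range (k + 1), ((-1 : ℚ) ^ (k + 1 - x) *
        ((M + (k + 1 - x)).choose (k + 1 - x) : ℚ) * ((M + 2 * (k + 1)).choose x : ℚ) -
        (-1 : ℚ) ^ (k - x) * ((M + (k - x)).choose (k - x) : ℚ) *
          ((M + 2 * (k + 1)).choose x : ℚ)) := by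
    refine Finset.sum_congr rfl fun x hx => ?_
    have hx' : k + 1 - x = k - x + 1 := by
      have := Finset.mem_range.1 hx
      omega
    rw [hx', inversionWeight]
    ring
  rw [h3, Finset.sum_sub_distrib, h2]
  have h4 : (2 * k + 1).choose (k + 1) = (2 * k + 1).choose k := by
    rw [← Nat.choose_symm_of_eq_add]
    omega
  rw [h4] at h1
  simp only [Nat.sub_self, inversionWeight, pow_zero, Nat.add_zero, Nat.choose_zero_right,
    Nat.cast_one, one_mul] at h1 ⊢
  linear_combination h1

/-- `h` excludes n = 2k+1, j = k, where the fraction is 0/0, evaluated as 0, but the weight is 1;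
hence the separate middle case of `gammaCoeff`. -/
theorem gammaWeight_eq_inversionWeight {n k j : ℕ} (hk : 2 * k + 1 ≤ n) (hj : j ≤ k)
    (h : 2 * k + 1 < n ∨ j < k) :
    gammaWeight n k j = inversionWeight (n - 1 - 2 * k) (k - j) := by
  obtain ⟨M, rfl⟩ := Nat.exists_eq_add_of_le hk
  obtain ⟨a, rfl⟩ := Nat.exists_eq_add_of_le hj
  have e1 : 2 * (j + a) + 1 + M - 1 - 2 * (j + a) = M := by omega
  have e2 : 2 * (j + a) + 1 + M - (j + a) - j - 1 = M + a := by omega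
  have e3 : j + a - j = a := by omega
  rw [gammaWeight, e1, e2, e3]
  have e4 : (((2 * (j + a) + 1 + M : ℕ) : ℚ) - 2 * j - 1) = M + 2 * a := by push_cast; ring
  have e5 : (((2 * (j + a) + 1 + M : ℕ) : ℚ) - (j + a : ℕ) - j - 1) = M + a := by push_cast; ring
  rw [e4, e5]
  rcases a with _ | a
  · have hM : (M : ℚ) ≠ 0 := by
      rw [Nat.cast_ne_zero]
      omega
    simp [inversionWeight, hM]
  · have hM : (M : ℚ) + ((a + 1 : ℕ) : ℚ) ≠ 0 := by positivity
    have hc := congrArg (Nat.cast (R := ℚ)) (Nat.add_one_mul_choose_eq (M + a) a)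
    push_cast at hc hM ⊢
    rw [inversionWeight, ← add_assoc M a 1]
    field_simp
    linear_combination -hc

theorem gammaCoeff_eq_sum {n k : ℕ} (hk : 2 * k + 1 ≤ n) :
    gammaCoeff n k = ∑ j ∈ Finset.range (k + 1),
      inversionWeight (n - 1 - 2 * k) (k - j) * (involutionNumber n j : ℚ) := by
  rw [gammaCoeff, if_neg (by omega)]
  simp only [Int.toNat_natCast]
  rcases hk.lt_or_eq with hk' | hk'
  · rw [if_pos (by omega)]
    refine Finset.sum_congr rfl fun j hj => ?_
    rw [gammaWeight_eq_inversionWeight hk (by simpa [Nat.lt_succ_iff] using hj) (Or.inl hk')]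
  · rw [if_neg (by omega), if_pos (by omega), Finset.sum_range_succ, add_comm]
    congr 1
    · refine Finset.sum_congr rfl fun j hj => ?_
      have hj := Finset.mem_range.1 hj
      rw [gammaWeight_eq_inversionWeight hk hj.le (Or.inr hj)]
    · simp [inversionWeight]

theorem gammaCoeff_of_neg {n : ℕ} {k : ℤ} (hk : k < 0) : gammaCoeff n k = 0 := by
  rw [gammaCoeff, if_pos hk]

theorem gammaCoeff_of_lt {n : ℕ} {k : ℤ} (hk : (n : ℤ) < 2 * k + 1) : gammaCoeff n k = 0 := by
  rw [gammaCoeff]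
  split_ifs <;> first | rfl | omega

theorem coeff_involutionPoly (n j : ℕ) :
    (involutionPoly n).coeff j = (involutionNumber n j : ℚ) := by
  simp [involutionPoly, involutionNumber, Polynomial.coeff_X_pow, eq_comm]

/-- After substitution, the total weight on b i vanishes for i < k by
`sum_inversionWeight_mul_choose`, and for i > k since t^i does not reach degrees at most k. -/
theorem gammaCoeff_eq_of_expansion {n : ℕ} {b : ℕ → ℚ}
    (hb : involutionPoly n = ∑ k ∈ Finset.range ((n - 1) / 2 + 1),
      Polynomial.C (b k) * Polynomial.X ^ k * (1 + Polynomial.X) ^ (n - 2 * k - 1))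
    {k : ℕ} (hk : 2 * k + 1 ≤ n) : gammaCoeff n k = b k := by
  have hI : ∀ j, (involutionNumber n j : ℚ) = ∑ i ∈ Finset.range ((n - 1) / 2 + 1),
      b i * if i ≤ j then ((n - 2 * i - 1).choose (j - i) : ℚ) else 0 := fun j => by
    rw [← coeff_involutionPoly, hb, Polynomial.finsetSum_coeff]
    refine Finset.sum_congr rfl fun i _ => ?_
    rw [mul_assoc, Polynomial.coeff_C_mul, Polynomial.coeff_X_pow_mul',
      Polynomial.coeff_one_add_X_pow]
  rw [gammaCoeff_eq_sum hk]
  simp only [hI, Finset.mul_sum]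
  rw [Finset.sum_comm, Finset.sum_eq_single k]
  · rw [Finset.sum_range_succ, Finset.sum_eq_zero]
    · simp [inversionWeight]
    · intro j hj
      rw [if_neg (by simpa using hj)]
      simp
  · intro i _ hik
    rcases lt_or_gt_of_ne hik with hik | hik
    · obtain ⟨d, rfl⟩ := Nat.exists_eq_add_of_le hik.le
      have h1 := sum_inversionWeight_mul_choose (n - 1 - 2 * (i + d)) d
      rw [if_neg (by omega)] at h1
      rw [add_assoc, Finset.sum_range_add, Finset.sum_eq_zero, zero_add]
      · rw [← mul_zero (b i), ← h1, Finset.mul_sum]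
        refine Finset.sum_congr rfl fun x _ => ?_
        have e1 : i + d - (i + x) = d - x := by omega
        have e2 : i + x - i = x := by omega
        have e3 : n - 1 - 2 * (i + d) + 2 * d = n - 2 * i - 1 := by omega
        rw [if_pos (by omega), e1, e2, e3]
        ring
      · intro j hj
        rw [if_neg (by simpa using hj)]
        simp
    · refine Finset.sum_eq_zero fun j hj => ?_
      have := Finset.mem_range.1 hj
      rw [if_neg (by omega)]
      simp
  · intro h
    exact absurd (Finset.mem_range.2 (by omega)) h

/-! ### Transfer of the recurrence to the coefficients -/

theorem geomSeries_ne_zero : geomSeries ≠ 0 := fun h => by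
  simpa [h] using geomSeries_mul_one_sub

open PowerSeries in
theorem gammaExpansion_iff {n R : ℕ} {b : ℕ → ℚ} (hb : ∀ k, n < 2 * k → b k = 0)
    (hR : n / 2 + 1 ≤ R) :
    symmetricPairsSeries (n + 1) = ∑ k ∈ Finset.range R, b k • gammaSeries (n + 1) k ↔
      involutionPoly (n + 1) = ∑ k ∈ Finset.range ((n + 1 - 1) / 2 + 1),
        Polynomial.C (b k) * Polynomial.X ^ k * (1 + Polynomial.X) ^ (n + 1 - 2 * k - 1) := by
  have hsum : ∑ k ∈ Finset.range R, b k • gammaSeries (n + 1) k =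
      X * ((∑ k ∈ Finset.range ((n + 1 - 1) / 2 + 1), Polynomial.C (b k) * Polynomial.X ^ k *
        (1 + Polynomial.X) ^ (n + 1 - 2 * k - 1) : Polynomial ℚ) : ℚ⟦X⟧) *
        geomSeries ^ (n + 2) := by
    rw [← Polynomial.coeToPowerSeries.ringHom_apply, map_sum, Finset.mul_sum, Finset.sum_mul]
    symm
    refine (Finset.sum_congr rfl fun k _ => ?_).trans (Finset.sum_subset
      (s₁ := Finset.range ((n + 1 - 1) / 2 + 1)) (Finset.range_mono (by simp; omega))
      fun k _ hk => ?_)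
    · have e : n + 1 - 2 * k - 1 = n + 1 - 1 - 2 * k := by omega
      simp only [e, gammaSeries, map_mul, map_pow, map_add, map_one,
        Polynomial.coeToPowerSeries.ringHom_apply, Polynomial.coe_C, Polynomial.coe_X,
        smul_eq_C_mul]
      ring
    · rw [hb k (by simp at hk; omega), zero_smul]
  rw [hsum, symmetricPairsSeries_succ]
  constructor
  · intro h
    have h1 := mul_right_cancel₀ (pow_ne_zero _ geomSeries_ne_zero) h
    exact Polynomial.coe_injective ℚ (mul_left_cancel₀ X_ne_zero h1)
  · intro h
    rw [← h]

open PowerSeries in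
theorem eulerOperator_eulerOperator_gammaSeries {n k : ℕ} (h : 2 * k ≤ n) :
    eulerOperator (eulerOperator (gammaSeries (n + 1) k)) =
      (((k : ℚ) + 1) ^ 2) • gammaSeries (n + 3) k +
      (2 * ((k : ℚ) + 1) * ((n : ℚ) + 1 - 2 * k) + 2 * ((n : ℚ) - 2 * k) * (k + 2)) •
        gammaSeries (n + 3) (k + 1) +
      (4 * ((n : ℚ) - 2 * k) * ((n : ℚ) - 2 * k - 1)) • gammaSeries (n + 3) (k + 2) := by
  rw [eulerOperator_gammaSeries (by omega), map_add, map_smul, map_smul,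
    eulerOperator_gammaSeries (by omega)]
  rcases h.lt_or_eq with h | h
  · rw [eulerOperator_gammaSeries (by omega)]
    push_cast
    module
  -- The second series is now outside the range of the derivative formula, but its coefficient 2(n -
  -- 2k) is zero.
  · have hn : (n : ℚ) = 2 * k := by exact_mod_cast h.symm
    push_cast
    rw [hn]
    module

theorem sum_range_shift {V : Type*} [AddCommGroup V] [Module ℚ V] (c : ℤ → ℚ) (ψ : ℕ → V)
    (R : ℕ) (h0 : c (-1) = 0) (hR : c R = 0) :
    ∑ k ∈ Finset.range (R + 1), c k • ψ (k + 1) =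
      ∑ k ∈ Finset.range (R + 1), c ((k : ℤ) - 1) • ψ k := by
  rw [Finset.sum_range_succ, Finset.sum_range_succ' (fun k => c ((k : ℤ) - 1) • ψ k)]
  simp [h0, hR]

/-- The right-hand side of the recurrence for the coefficients `gammaCoeff n k`. -/
noncomputable def gammaRecurrence (n : ℕ) (k : ℤ) : ℚ :=
  ((k : ℚ) + 1) * gammaCoeff (n - 1) k
    + (2 * (n : ℚ) - 4 * (k : ℚ)) * gammaCoeff (n - 1) (k - 1)
    + ((k : ℚ) * ((k : ℚ) + 2) + (n : ℚ) - 1) * gammaCoeff (n - 2) k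
    + (((k : ℚ) - 1) * (4 * (n : ℚ) - 8 * (k : ℚ) - 14) + 2 * (n : ℚ) - 8)
        * gammaCoeff (n - 2) (k - 1)
    + 4 * ((n : ℚ) - 2 * (k : ℚ)) * ((n : ℚ) - 2 * (k : ℚ) + 1)
        * gammaCoeff (n - 2) (k - 2)

/-- Each coefficient still in range is multiplied by a vanishing factor n - 2k or n - 2k + 1. -/
theorem gammaRecurrence_of_lt {n : ℕ} {k : ℤ} (hn : 3 ≤ n) (hk : (n : ℤ) < 2 * k + 1) :
    gammaRecurrence n k = 0 := by
  have h1 : (2 * (n : ℚ) - 4 * (k : ℚ)) * gammaCoeff (n - 1) (k - 1) = 0 := by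
    rcases eq_or_ne (n : ℤ) (2 * k) with h | h
    · have : (n : ℚ) = 2 * k := by exact_mod_cast h
      rw [this]
      ring
    · rw [gammaCoeff_of_lt (by omega), mul_zero]
  have h2 : 4 * ((n : ℚ) - 2 * (k : ℚ)) * ((n : ℚ) - 2 * (k : ℚ) + 1)
      * gammaCoeff (n - 2) (k - 2) = 0 := by
    rcases eq_or_ne (n : ℤ) (2 * k) with h | h
    · have : (n : ℚ) = 2 * k := by exact_mod_cast h
      rw [this]
      ring
    · rcases eq_or_ne (n : ℤ) (2 * k - 1) with h' | h'
      · have : (n : ℚ) = 2 * k - 1 := by exact_mod_cast h'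
        rw [this]
        ring
      · rw [gammaCoeff_of_lt (by omega), mul_zero]
  rw [gammaRecurrence, h1, h2, gammaCoeff_of_lt (n := n - 1) (k := k) (by omega),
    gammaCoeff_of_lt (n := n - 2) (k := k) (by omega),
    gammaCoeff_of_lt (n := n - 2) (k := k - 1) (by omega)]
  ring

open PowerSeries in
theorem symmetricPairsSeries_eq_gammaRecurrence {n R : ℕ} (hR : n + 3 ≤ R)
    (h1 : symmetricPairsSeries (n + 1) =
      ∑ k ∈ Finset.range (R + 1), gammaCoeff (n + 1) k • gammaSeries (n + 1) k)
    (h2 : symmetricPairsSeries (n + 2) =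
      ∑ k ∈ Finset.range (R + 1), gammaCoeff (n + 2) k • gammaSeries (n + 2) k) :
    symmetricPairsSeries (n + 3) =
      ∑ k ∈ Finset.range (R + 1),
        (gammaRecurrence (n + 3) k / ((n + 3 : ℕ) : ℚ)) • gammaSeries (n + 3) k := by
  have hn : ((n + 3 : ℕ) : ℚ) ≠ 0 := by positivity
  have key : ((n + 3 : ℕ) : ℚ) • symmetricPairsSeries (n + 3) =
      ∑ k ∈ Finset.range (R + 1), gammaRecurrence (n + 3) k • gammaSeries (n + 3) k := by
    -- `c0`, `c1`, `c2` collect the contributions at index shifts 0, 1, 2. The terms n + 1 and -4(n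
    -- + 1) come from raising `gammaSeries (n + 1) k` to level n + 3.
    let c0 : ℤ → ℚ := fun k => ((k : ℚ) + 1) * gammaCoeff (n + 2) k +
      (((k : ℚ) + 1) ^ 2 + (n + 1)) * gammaCoeff (n + 1) k
    let c1 : ℤ → ℚ := fun k => 2 * ((n : ℚ) + 1 - 2 * k) * gammaCoeff (n + 2) k +
      (2 * ((k : ℚ) + 1) * ((n : ℚ) + 1 - 2 * k) + 2 * ((n : ℚ) - 2 * k) * (k + 2) -
        4 * (n + 1)) * gammaCoeff (n + 1) k
    let c2 : ℤ → ℚ := fun k =>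
      (4 * ((n : ℚ) - 2 * k) * ((n : ℚ) - 2 * k - 1)) * gammaCoeff (n + 1) k
    have hsplit : ((n + 3 : ℕ) : ℚ) • symmetricPairsSeries (n + 3) =
        ∑ k ∈ Finset.range (R + 1), c0 k • gammaSeries (n + 3) k +
        ∑ k ∈ Finset.range (R + 1), c1 k • gammaSeries (n + 3) (k + 1) +
        ∑ k ∈ Finset.range (R + 1), c2 k • gammaSeries (n + 3) (k + 2) := by
      have e : ((n + 3 : ℕ) : ℚ) = ((n + 1 : ℕ) : ℚ) + 2 := by push_cast; ring
      rw [e, symmetricPairsSeries_recurrence (n + 1), h1, h2, map_sum, map_sum, map_sum,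
        Finset.smul_sum, ← Finset.sum_add_distrib, ← Finset.sum_add_distrib,
        ← Finset.sum_add_distrib, ← Finset.sum_add_distrib]
      refine Finset.sum_congr rfl fun k _ => ?_
      simp only [map_smul, c0, c1, c2, Int.cast_natCast]
      -- At 2k = n + 1 only the coefficient of level n + 2 survives; beyond that, neither.
      by_cases ha : 2 * k ≤ n
      · rw [eulerOperator_eulerOperator_gammaSeries ha, eulerOperator_gammaSeries (by omega),
          gammaSeries_eq (n := n + 1) (by omega)]
        push_cast
        module
      · rw [gammaCoeff_of_lt (n := n + 1) (k := k) (by omega)]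
        by_cases hb : 2 * k ≤ n + 1
        · rw [eulerOperator_gammaSeries (by omega)]
          push_cast
          module
        · rw [gammaCoeff_of_lt (n := n + 2) (k := k) (by omega)]
          simp
    have hc1 : ∑ k ∈ Finset.range (R + 1), c1 k • gammaSeries (n + 3) (k + 1) =
        ∑ k ∈ Finset.range (R + 1), c1 ((k : ℤ) - 1) • gammaSeries (n + 3) k := by
      apply sum_range_shift c1 (gammaSeries (n + 3)) R
      · simp only [c1]
        rw [gammaCoeff_of_neg (by omega), gammaCoeff_of_neg (by omega)]
        ring
      · simp only [c1]
        rw [gammaCoeff_of_lt (by omega), gammaCoeff_of_lt (by omega)]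
        ring
    have hc2 : ∑ k ∈ Finset.range (R + 1), c2 k • gammaSeries (n + 3) (k + 2) =
        ∑ k ∈ Finset.range (R + 1), c2 ((k : ℤ) - 2) • gammaSeries (n + 3) k := by
      rw [sum_range_shift c2 (fun k => gammaSeries (n + 3) (k + 1)) R,
        sum_range_shift (fun k => c2 (k - 1)) (gammaSeries (n + 3)) R]
      · refine Finset.sum_congr rfl fun k _ => ?_
        congr 2
        ring
      · simp only [c2]
        rw [gammaCoeff_of_neg (by omega), mul_zero]
      · simp only [c2]
        rw [gammaCoeff_of_lt (by omega), mul_zero]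
      · simp only [c2]
        rw [gammaCoeff_of_neg (by omega), mul_zero]
      · simp only [c2]
        rw [gammaCoeff_of_lt (by omega), mul_zero]
    rw [hsplit, hc1, hc2, ← Finset.sum_add_distrib, ← Finset.sum_add_distrib]
    refine Finset.sum_congr rfl fun k _ => ?_
    rw [← add_smul, ← add_smul]
    congr 1
    simp only [c0, c1, c2, gammaRecurrence,
      show n + 3 - 1 = n + 2 from rfl, show n + 3 - 2 = n + 1 from rfl]
    push_cast
    ring
  rw [← inv_smul_smul₀ hn (symmetricPairsSeries (n + 3)), key, Finset.smul_sum]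
  refine Finset.sum_congr rfl fun k _ => ?_
  rw [smul_smul, div_eq_inv_mul]

/-- The expansion of `involutionPoly n` with coefficients `gammaCoeff n k`. -/
def HasGammaExpansion (n : ℕ) : Prop :=
  involutionPoly n = ∑ k ∈ Finset.range ((n - 1) / 2 + 1),
    Polynomial.C (gammaCoeff n (k : ℤ)) * Polynomial.X ^ k *
      (1 + Polynomial.X) ^ (n - 2 * k - 1)

theorem hasGammaExpansion_of_expansion {n : ℕ} (hn : 1 ≤ n) {b : ℕ → ℚ}
    (hb : involutionPoly n = ∑ k ∈ Finset.range ((n - 1) / 2 + 1),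
      Polynomial.C (b k) * Polynomial.X ^ k * (1 + Polynomial.X) ^ (n - 2 * k - 1)) :
    HasGammaExpansion n := by
  unfold HasGammaExpansion
  rw [hb]
  refine Finset.sum_congr rfl fun k hk => ?_
  have := Finset.mem_range.1 hk
  rw [gammaCoeff_eq_of_expansion hb (by omega)]

theorem hasGammaExpansion_one : HasGammaExpansion 1 := by
  refine hasGammaExpansion_of_expansion le_rfl (b := fun _ => 1) ?_
  have h : involutions 1 = {1} := by decide
  have hd : descentNumber (1 : Equiv.Perm (Fin 1)) = 0 := by decide
  simp [involutionPoly, h, hd]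

theorem hasGammaExpansion_two : HasGammaExpansion 2 := by
  refine hasGammaExpansion_of_expansion (by omega) (b := fun _ => 1) ?_
  have h : involutions 2 = {1, Equiv.swap 0 1} := by decide
  have hne : (1 : Equiv.Perm (Fin 2)) ≠ Equiv.swap 0 1 := by decide
  have hd : descentNumber (1 : Equiv.Perm (Fin 2)) = 0 := by decide
  have hd' : descentNumber (Equiv.swap 0 1 : Equiv.Perm (Fin 2)) = 1 := by decide
  rw [involutionPoly, h, Finset.sum_pair hne, hd, hd']
  simp

theorem involutionPoly_eq_gammaRecurrence {n : ℕ} (h1 : HasGammaExpansion (n + 1))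
    (h2 : HasGammaExpansion (n + 2)) :
    involutionPoly (n + 3) = ∑ k ∈ Finset.range ((n + 3 - 1) / 2 + 1),
      Polynomial.C (gammaRecurrence (n + 3) k / ((n + 3 : ℕ) : ℚ)) * Polynomial.X ^ k *
        (1 + Polynomial.X) ^ (n + 3 - 2 * k - 1) := by
  refine (gammaExpansion_iff (n := n + 2) (R := n + 3 + 1)
    (b := fun k => gammaRecurrence (n + 3) k / ((n + 3 : ℕ) : ℚ)) (fun k hk => ?_)
    (by omega)).1 (symmetricPairsSeries_eq_gammaRecurrence le_rfl ?_ ?_)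
  · rw [gammaRecurrence_of_lt (by omega) (by push_cast; omega), zero_div]
  · exact (gammaExpansion_iff (n := n) (b := fun k => gammaCoeff (n + 1) k)
      (fun k hk => gammaCoeff_of_lt (by push_cast; omega)) (by omega)).2 h1
  · exact (gammaExpansion_iff (n := n + 1) (b := fun k => gammaCoeff (n + 2) k)
      (fun k hk => gammaCoeff_of_lt (by push_cast; omega)) (by omega)).2 h2

theorem hasGammaExpansion_succ (n : ℕ) : HasGammaExpansion (n + 1) := by
  induction n using Nat.strong_induction_on with
  | _ n ih =>
    match n, ih with
    | 0, _ => exact hasGammaExpansion_one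
    | 1, _ => exact hasGammaExpansion_two
    | n + 2, ih =>
      exact hasGammaExpansion_of_expansion (by omega)
        (b := fun k => gammaRecurrence (n + 3) k / ((n + 3 : ℕ) : ℚ))
        (involutionPoly_eq_gammaRecurrence (ih n (by omega)) (ih (n + 1) (by omega)))

/-- In range, uniqueness identifies a_{n,k} with the coefficient produced by the recurrence; out of
range both sides vanish. -/
theorem mul_gammaCoeff_eq_gammaRecurrence {n : ℕ} (hn : 3 ≤ n) {k : ℤ} (hk : 0 ≤ k) :
    (n : ℚ) * gammaCoeff n k = gammaRecurrence n k := by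
  rcases lt_or_ge (n : ℤ) (2 * k + 1) with h | h
  · rw [gammaCoeff_of_lt h, gammaRecurrence_of_lt hn h, mul_zero]
  · obtain ⟨n, rfl⟩ := Nat.exists_eq_add_of_le' hn
    obtain ⟨k, rfl⟩ := Int.eq_ofNat_of_zero_le hk
    rw [gammaCoeff_eq_of_expansion
      (b := fun k => gammaRecurrence (n + 3) k / ((n + 3 : ℕ) : ℚ))
      (involutionPoly_eq_gammaRecurrence (hasGammaExpansion_succ n)
        (hasGammaExpansion_succ (n + 1))) (by omega)]
    exact mul_div_cancel₀ _ (by positivity)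

theorem mainTheorem6 :
    (∀ n : ℕ, 1 ≤ n →
      involutionPoly n =
        ∑ k ∈ Finset.range ((n - 1) / 2 + 1),
          Polynomial.C (gammaCoeff n (k : ℤ)) * Polynomial.X ^ k *
            (1 + Polynomial.X) ^ (n - 2 * k - 1)) ∧
    (∀ (n : ℕ) (k : ℤ), 3 ≤ n → 0 ≤ k →
      (n : ℚ) * gammaCoeff n k =
        ((k : ℚ) + 1) * gammaCoeff (n - 1) k
        + (2 * (n : ℚ) - 4 * (k : ℚ)) * gammaCoeff (n - 1) (k - 1)
        + ((k : ℚ) * ((k : ℚ) + 2) + (n : ℚ) - 1) * gammaCoeff (n - 2) k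
        + (((k : ℚ) - 1) * (4 * (n : ℚ) - 8 * (k : ℚ) - 14) + 2 * (n : ℚ) - 8)
            * gammaCoeff (n - 2) (k - 1)
        + 4 * ((n : ℚ) - 2 * (k : ℚ)) * ((n : ℚ) - 2 * (k : ℚ) + 1)
            * gammaCoeff (n - 2) (k - 2)) := by
  refine ⟨fun n hn => ?_, fun n k hn hk => mul_gammaCoeff_eq_gammaRecurrence hn hk⟩
  obtain ⟨n, rfl⟩ := Nat.exists_eq_add_of_le' hn
  exact hasGammaExpansion_succ n
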